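/- Let $K$ be an algebraically closed field of characteristic $\neq 2$. For $1\le k\le 13$ let $J_{4,k}$ be the commutative $K$-algebra with basis $a,b,c,d$ and commutative product $\circ$ given by the following table, where $x^2=x\circ x$ and all products of basis vectors not determined by the table and commutativity are zero: - $J_{4,1}$: all products are zero; - $J_{4,2}$: $a^2=b$; - $J_{4,3}$: $a^2=c,\ b^2=c$; - $J_{4,4}$: $a^2=b,\ a\circ b=c$; - $J_{4,5}$: $a^2=d,\ b^2=d,\ c^2=d$; - $J_{4,6}$: $a^2=b,\ b\circ c=d$; - $J_{4,7}$: $a^2=b,\ a\circ b=d,\ c^2=d$; - $J_{4,8}$: $a^2=c,\ b^2=c,\ a\circ c=d$; - $J_{4,9}$: $a^2=c,\ b^2=-c,\ a\circ c=d,\ b\circ c=d$; - $J_{4,10}$: $a^2=c,\ b^2=-c,\ a\circ c=d,\ b\circ c=d,\ a\circ b=d$; - $J_{4,11}$: $a^2=b,\ a\circ b=c,\ a\circ c=d,\ b^2=d$; - $J_{4,12}$: $a^2=c,\ a\circ b=d$; - $J_{4,13}$: $a^2=c,\ b^2=c,\ a\circ b=d$. Call an algebra $A$ nilpotent if its lower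 central series $A\supseteq A\circ A\supseteq (A\circ A)\circ A\supseteq\cdots$ reaches $0$. Up to isomorphism there are exactly $9$ commutative nilpotent associative $K$-algebras of dimension $4$ (no unit is assumed), namely $$J_{4,1},\ J_{4,2},\ J_{4,3},\ J_{4,4},\ J_{4,5},\ J_{4,7},\ J_{4,11},\ J_{4,12},\ J_{4,13}.$$ That is, these nine algebras are $4$-dimensional, commutative, associative and nilpotent, they are pairwise non-isomorphic, and every $4$-dimensional commutative nilpotent associative $K$-algebra is isomorphic to one of them. They are exactly the associative algebras among $J_{4,1},\dots,J_{4,13}$. Moreover $J_{4,1},J_{4,2},J_{4,3},J_{4,4}$ have a nonzero central component, i.e. each is a direct sum of two ideals of which one is nonzero and annihilates the whole algebra, and the other five algebras do not. -/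

import Mathlib

namespace NilpotentAlgebra

section General

variable (K : Type*) [Field K]

/-- The lower central series of a (not necessarily associative) algebra, indexed from `0`:
`lowerSeries K A 0 = A`, and `lowerSeries K A (n + 1)` is the linear span of all products `x * y`
with `x ∈ lowerSeries K A n` and `y ∈ A`. -/
def lowerSeries (A : Type*) [NonUnitalNonAssocCommRing A] [Module K A] [IsScalarTower K A A]
    [SMulCommClass K A A] : ℕ → Submodule K A
  | 0 => ⊤
  | n + 1 => Submodule.map₂ (LinearMap.mul K A) (lowerSeries A n) ⊤

/-- An algebra is nilpotent if its lower central series reaches zero. -/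
def IsNilpotentAlg (A : Type*) [NonUnitalNonAssocCommRing A] [Module K A] [IsScalarTower K A A]
    [SMulCommClass K A A] : Prop :=
  ∃ n : ℕ, lowerSeries K A n = ⊥

/-- Isomorphism of `K`-algebras: a linear bijection that preserves products. -/
def Isomorphic (A B : Type*) [NonUnitalNonAssocCommRing A] [Module K A]
    [NonUnitalNonAssocCommRing B] [Module K B] : Prop :=
  ∃ e : A ≃ₗ[K] B, ∀ x y : A, e (x * y) = e x * e y

/-- A commutative algebra has a central component if it is the direct sum of two ideals `I₁`, `I₂`
with `I₂` nonzero and contained in the centre (that is, in the annihilator of the algebra). -/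
def HasCentralComponent (A : Type*) [NonUnitalNonAssocCommRing A] [Module K A] : Prop :=
  ∃ I₁ I₂ : Submodule K A, IsCompl I₁ I₂ ∧ I₂ ≠ ⊥ ∧
    (∀ x ∈ I₁, ∀ y : A, x * y ∈ I₁) ∧ (∀ x ∈ I₂, ∀ y : A, x * y ∈ I₂) ∧
    (∀ x ∈ I₂, ∀ y : A, x * y = 0)

end General

/-- The multiplication table of the algebra `J_{4,k}`, `1 ≤ k ≤ 13`, in a basis `a, b, c, d`.
An entry `(x, y, s, z)` says `x ∘ y = y ∘ x = s • z`; all products of basis vectors that are not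
listed are zero. -/
def table (k : ℕ) : List (Fin 4 × Fin 4 × ℤ × Fin 4) :=
  let a : Fin 4 := 0
  let b : Fin 4 := 1
  let c : Fin 4 := 2
  let d : Fin 4 := 3
  match k with
  | 1 => []
  | 2 => [(a, a, 1, b)]
  | 3 => [(a, a, 1, c), (b, b, 1, c)]
  | 4 => [(a, a, 1, b), (a, b, 1, c)]
  | 5 => [(a, a, 1, d), (b, b, 1, d), (c, c, 1, d)]
  | 6 => [(a, a, 1, b), (b, c, 1, d)]
  | 7 => [(a, a, 1, b), (a, b, 1, d), (c, c, 1, d)]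
  | 8 => [(a, a, 1, c), (b, b, 1, c), (a, c, 1, d)]
  | 9 => [(a, a, 1, c), (b, b, -1, c), (a, c, 1, d), (b, c, 1, d)]
  | 10 => [(a, a, 1, c), (b, b, -1, c), (a, c, 1, d), (b, c, 1, d), (a, b, 1, d)]
  | 11 => [(a, a, 1, b), (a, b, 1, c), (a, c, 1, d), (b, b, 1, d)]
  | 12 => [(a, a, 1, c), (a, b, 1, d)]
  | 13 => [(a, a, 1, c), (b, b, 1, c), (a, b, 1, d)]
  | _ => []

/-- The coefficient of the basis vector `m` in the product of the basis vectors `i` and `j`. -/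
def structConst (k : ℕ) (i j m : Fin 4) : ℤ :=
  ((table k).map fun t =>
    if ((t.1 = i ∧ t.2.1 = j) ∨ (t.1 = j ∧ t.2.1 = i)) ∧ t.2.2.2 = m then t.2.2.1 else 0).sum

theorem structConst_comm (k : ℕ) (i j m : Fin 4) :
    structConst k i j m = structConst k j i m := by
  unfold structConst
  simp only [or_comm]

/-- The algebra `J_{4,k}` over `K`: its vectors are the coordinate vectors with respect to the
basis `a, b, c, d`. -/
def J4 (K : Type*) (_k : ℕ) : Type _ := Fin 4 → K

section J4

variable {K : Type*} [Field K] {k : ℕ}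

instance : AddCommGroup (J4 K k) := inferInstanceAs (AddCommGroup (Fin 4 → K))

instance : Module K (J4 K k) := inferInstanceAs (Module K (Fin 4 → K))

instance : Mul (J4 K k) where
  mul x y := fun m => ∑ i, ∑ j, (structConst k i j m : K) * (x i * y j)

theorem J4.mul_apply (x y : J4 K k) (m : Fin 4) :
    (x * y) m = ∑ i, ∑ j, (structConst k i j m : K) * (x i * y j) := rfl

theorem J4.add_apply (x y : J4 K k) (m : Fin 4) : (x + y) m = x m + y m := rfl

theorem J4.zero_apply (m : Fin 4) : (0 : J4 K k) m = 0 := rfl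

theorem J4.smul_apply (r : K) (x : J4 K k) (m : Fin 4) : (r • x) m = r * x m := rfl

instance : NonUnitalNonAssocCommRing (J4 K k) where
  left_distrib x y z := by
    funext m
    simp only [J4.mul_apply, J4.add_apply, mul_add, Finset.sum_add_distrib]
  right_distrib x y z := by
    funext m
    simp only [J4.mul_apply, J4.add_apply, add_mul, mul_add, Finset.sum_add_distrib]
  zero_mul x := by
    funext m
    simp only [J4.mul_apply, J4.zero_apply, zero_mul, mul_zero, Finset.sum_const_zero]
  mul_zero x := by
    funext m
    simp only [J4.mul_apply, J4.zero_apply, mul_zero, Finset.sum_const_zero]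
  mul_comm x y := by
    funext m
    rw [J4.mul_apply, J4.mul_apply, Finset.sum_comm]
    refine Finset.sum_congr rfl fun i _ => Finset.sum_congr rfl fun j _ => ?_
    rw [structConst_comm, mul_comm (x j)]

instance : IsScalarTower K (J4 K k) (J4 K k) where
  smul_assoc r x y := by
    funext m
    simp only [smul_eq_mul, J4.mul_apply, J4.smul_apply, Finset.mul_sum]
    refine Finset.sum_congr rfl fun i _ => Finset.sum_congr rfl fun j _ => ?_
    ring

instance : SMulCommClass K (J4 K k) (J4 K k) where
  smul_comm r x y := by
    funext m
    simp only [smul_eq_mul, J4.mul_apply, J4.smul_apply, Finset.mul_sum]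
    refine Finset.sum_congr rfl fun i _ => Finset.sum_congr rfl fun j _ => ?_
    ring

end J4

/-- The nine indices `k` of the commutative nilpotent associative algebras `J_{4,k}`. -/
def assocIndices : Finset ℕ := {1, 2, 3, 4, 5, 7, 11, 12, 13}

end NilpotentAlgebra

/-! Write `A^(n+1)` for `lowerSeries K A n`. In each of the nine models a product of two basis
vectors is zero or a basis vector, so the powers and the annihilator are spanned by basis vectors,
and nilpotency, associativity and all dimensions become finite checks by `decide`. The dimensions of
`A^2`, `A^3` and the annihilator separate every pair except 12 and 13; these differ because only
`J_{4,12}` has a square-zero element outside its annihilator.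

For completeness, split on `dim A^2`, which is at most 3 by nilpotency. Dimension 0 gives `J_{4,1}`.
Dimension 3 means one generator `x`, with basis `x, x^2, x^3, x^4` (`isomorphic_eleven`). In
dimension 1 the product is a symmetric bilinear form on a complement of `A^2`; diagonalised and
rescaled by square roots, it is determined by its rank (`exists_isomorphic_of_finrank_one`). In
dimension 2 with `A^3 = 0`, two generators satisfy one quadratic relation, which factors as `p^2 =
0` or `p * q = 0` (`exists_isomorphic_of_square_eq_bot`). In dimension 2 with `A^3 ≠ 0`, there is
`x` with `x^3 ≠ 0`, and a second generator can be chosen with `x * y = 0` and `y^2` a multiple of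
`x^3` (`exists_isomorphic_of_square_ne_bot`). -/

namespace NilpotentAlgebra

/-! ### Isomorphism invariants and the obstruction to a central component. -/

section LowerSeries

variable {K : Type*} [Field K]

theorem map_lowerSeries {A B : Type*}
    [NonUnitalNonAssocCommRing A] [Module K A] [IsScalarTower K A A] [SMulCommClass K A A]
    [NonUnitalNonAssocCommRing B] [Module K B] [IsScalarTower K B B] [SMulCommClass K B B]
    (e : A ≃ₗ[K] B) (he : ∀ x y : A, e (x * y) = e x * e y) (n : ℕ) :
    (lowerSeries K A n).map (e : A →ₗ[K] B) = lowerSeries K B n := by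
  induction n with
  | zero =>
    change Submodule.map _ ⊤ = ⊤
    rw [Submodule.map_top, LinearEquiv.range]
  | succ n ih =>
    have htop : (⊤ : Submodule K B) = (⊤ : Submodule K A).map (e : A →ₗ[K] B) := by
      rw [Submodule.map_top, LinearEquiv.range]
    change Submodule.map _ (Submodule.map₂ _ _ ⊤) = Submodule.map₂ _ _ ⊤
    rw [← ih, htop, Submodule.map_map₂, Submodule.map₂_map_map]
    congr 1
    ext x y
    simp [he]

/-- The annihilator of a commutative algebra. -/
def annihilator (K A : Type*) [Field K] [NonUnitalNonAssocCommRing A] [Module K A]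
    [IsScalarTower K A A] : Submodule K A where
  carrier := {x | ∀ y, x * y = 0}
  add_mem' hx hy z := by rw [add_mul, hx z, hy z, add_zero]
  zero_mem' z := zero_mul z
  smul_mem' r x hx z := by rw [smul_mul_assoc, hx z, smul_zero]

theorem map_annihilator {A B : Type*}
    [NonUnitalNonAssocCommRing A] [Module K A] [IsScalarTower K A A]
    [NonUnitalNonAssocCommRing B] [Module K B] [IsScalarTower K B B]
    (e : A ≃ₗ[K] B) (he : ∀ x y : A, e (x * y) = e x * e y) :
    (annihilator K A).map (e : A →ₗ[K] B) = annihilator K B := by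
  ext b
  constructor
  · rintro ⟨a, ha, rfl⟩ y
    obtain ⟨y, rfl⟩ := e.surjective y
    change e a * e y = 0
    rw [← he, ha y, map_zero]
  · intro hb
    refine ⟨e.symm b, fun y => e.injective ?_, by simp⟩
    rw [he, e.apply_symm_apply, map_zero]
    exact hb _

/-- A central summand `J` contributes nothing to products, so `A^2` lies in the other summand `I`.
Then `J ≤ annihilator ≤ A^2 ≤ I` contradicts disjointness. -/
theorem not_hasCentralComponent {A : Type*} [NonUnitalNonAssocCommRing A] [Module K A]
    [IsScalarTower K A A] [SMulCommClass K A A] (h : annihilator K A ≤ lowerSeries K A 1) :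
    ¬ HasCentralComponent K A := by
  rintro ⟨I, J, hIJ, hJ, hI, -, hJ0⟩
  have hJA : J ≤ annihilator K A := fun x hx => hJ0 x hx
  refine hJ (hIJ.disjoint.symm.eq_bot_of_le
    (hJA.trans (h.trans (Submodule.map₂_le.2 fun x _ y _ => ?_))))
  obtain ⟨u, hu, v, hv, rfl⟩ := Submodule.mem_sup.1 (hIJ.sup_eq_top ▸ Submodule.mem_top : x ∈ I ⊔ J)
  simpa [add_mul, hJ0 v hv y] using hI u hu y

end LowerSeries

/-! ### Coordinate subspaces: powers and annihilator of the models. -/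

@[ext]
theorem J4.ext {K : Type*} {k : ℕ} {x y : J4 K k} (h : ∀ m, x m = y m) : x = y := funext h

section Coordinates

variable {K : Type*} [Field K] {k : ℕ}

/-- The basis vectors of `J4 K k`. -/
def J4.e (K : Type*) [Field K] (k : ℕ) (i : Fin 4) : J4 K k := Pi.single i (1 : K)

theorem J4.e_apply (i j : Fin 4) : J4.e K k i j = if j = i then 1 else 0 :=
  Pi.single_apply i (1 : K) j

theorem J4.mul_e_apply (x : J4 K k) (j m : Fin 4) :
    (x * J4.e K k j) m = ∑ i, (structConst k i j m : K) * x i := by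
  simp [J4.mul_apply, J4.e_apply]

theorem J4.e_mul_e_apply (i j m : Fin 4) :
    (J4.e K k i * J4.e K k j) m = structConst k i j m := by
  simp [J4.mul_e_apply, J4.e_apply]

theorem J4.finrank : Module.finrank K (J4 K k) = 4 :=
  (Module.finrank_fin_fun K : Module.finrank K (Fin 4 → K) = 4)

/-- The span of the basis vectors indexed by `S`. -/
def coordSubspace (K : Type*) [Field K] (k : ℕ) (S : Finset (Fin 4)) : Submodule K (J4 K k) where
  carrier := {x | ∀ i ∉ S, x i = 0}
  add_mem' hx hy i hi := by rw [J4.add_apply, hx i hi, hy i hi, add_zero]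
  zero_mem' _ _ := rfl
  smul_mem' r x hx i hi := by rw [J4.smul_apply, hx i hi, mul_zero]

theorem mem_coordSubspace {S : Finset (Fin 4)} {x : J4 K k} :
    x ∈ coordSubspace K k S ↔ ∀ i ∉ S, x i = 0 := Iff.rfl

theorem coordSubspace_univ : coordSubspace K k Finset.univ = ⊤ :=
  eq_top_iff.2 fun _ _ _ hi => (hi (Finset.mem_univ _)).elim

theorem coordSubspace_empty : coordSubspace K k ∅ = ⊥ :=
  eq_bot_iff.2 fun _ hx => J4.ext fun i => hx i (Finset.notMem_empty i)

theorem coordSubspace_mono {S T : Finset (Fin 4)} (h : S ⊆ T) :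
    coordSubspace K k S ≤ coordSubspace K k T := fun _ hx i hi => hx i fun hS => hi (h hS)

theorem e_mem_coordSubspace {S : Finset (Fin 4)} {i : Fin 4} (hi : i ∈ S) :
    J4.e K k i ∈ coordSubspace K k S := fun j hj => by
  rw [J4.e_apply, if_neg]
  rintro rfl
  exact hj hi

theorem finrank_coordSubspace (S : Finset (Fin 4)) :
    Module.finrank K (coordSubspace K k S) = S.card := by
  have e : coordSubspace K k S ≃ₗ[K] (S → K) :=
    { toFun x i := x.1 i
      map_add' _ _ := rfl
      map_smul' _ _ := rfl
      invFun f := ⟨fun i => if h : i ∈ S then f ⟨i, h⟩ else 0, fun i hi => dif_neg hi⟩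
      left_inv x := Subtype.ext (funext fun i => by
        by_cases h : i ∈ S
        · exact dif_pos h
        · exact (dif_neg h).trans (x.2 i h).symm)
      right_inv f := funext fun i => dif_pos i.2 }
  rw [e.finrank_eq, Module.finrank_fintype_fun_eq_card, Fintype.card_coe]

theorem coordSubspace_le {S : Finset (Fin 4)} {P : Submodule K (J4 K k)}
    (h : ∀ i ∈ S, J4.e K k i ∈ P) : coordSubspace K k S ≤ P := by
  intro x hx
  have hsum : x = ∑ i, x i • J4.e K k i :=
    (pi_eq_sum_univ (x : Fin 4 → K)).trans (Finset.sum_congr rfl fun i _ => J4.ext fun j => by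
      change x i * _ = x i * _
      rw [J4.e_apply]
      simp only [eq_comm])
  rw [hsum]
  refine Submodule.sum_mem _ fun i _ => ?_
  by_cases hi : i ∈ S
  · exact P.smul_mem _ (h i hi)
  · rw [hx i hi, zero_smul]
    exact P.zero_mem

/-- The indices of the basis vectors that span the `n`-th term of the lower central series. -/
def lowerIndices (k : ℕ) : ℕ → Finset (Fin 4)
  | 0 => Finset.univ
  | n + 1 => Finset.univ.filter fun m => ∃ i ∈ lowerIndices k n, ∃ j, structConst k i j m ≠ 0

/-- The indices of the basis vectors that span the annihilator. -/
def annihilatorIndices (k : ℕ) : Finset (Fin 4) :=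
  Finset.univ.filter fun i => ∀ j m, structConst k i j m = 0

/-- This makes every power a coordinate subspace: a basis vector that occurs in a product is itself
that product. -/
theorem structConst_monomial : ∀ k ∈ assocIndices, ∀ i j m : Fin 4, structConst k i j m ≠ 0 →
    ∀ m', structConst k i j m' = if m' = m then 1 else 0 := by
  decide

theorem lowerSeries_eq_coordSubspace (hk : k ∈ assocIndices) (n : ℕ) :
    lowerSeries K (J4 K k) n = coordSubspace K k (lowerIndices k n) := by
  induction n with
  | zero => exact coordSubspace_univ.symm
  | succ n ih =>
    change Submodule.map₂ _ (lowerSeries K (J4 K k) n) ⊤ = _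
    rw [ih]
    apply le_antisymm
    · refine Submodule.map₂_le.2 fun x hx y _ m hm => ?_
      have hm' : ∀ i ∈ lowerIndices k n, ∀ j, structConst k i j m = 0 := by
        simpa [lowerIndices] using hm
      change ∑ i, ∑ j, (structConst k i j m : K) * (x i * y j) = 0
      refine Finset.sum_eq_zero fun i _ => Finset.sum_eq_zero fun j _ => ?_
      by_cases hi : i ∈ lowerIndices k n
      · rw [hm' i hi j, Int.cast_zero, zero_mul]
      · rw [hx i hi, zero_mul, mul_zero]
    · refine coordSubspace_le fun m hm => ?_
      obtain ⟨i, hi, j, hij⟩ : ∃ i ∈ lowerIndices k n, ∃ j, structConst k i j m ≠ 0 := by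
        simpa [lowerIndices] using hm
      have : J4.e K k m = LinearMap.mul K _ (J4.e K k i) (J4.e K k j) := by
        ext m'
        rw [LinearMap.mul_apply', J4.e_mul_e_apply, structConst_monomial k hk i j m hij m',
          J4.e_apply]
        split_ifs <;> simp
      rw [this]
      exact Submodule.apply_mem_map₂ _ (e_mem_coordSubspace hi) Submodule.mem_top

/-- For such `j, m` the `m`-th coordinate of `x * e_j` is exactly `x i`, so an annihilating `x` has
`x i = 0`. -/
theorem exists_structConst_isolating : ∀ k ∈ assocIndices, ∀ i ∉ annihilatorIndices k,
    ∃ j m, ∀ i', structConst k i' j m = if i' = i then 1 else 0 := by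
  decide

theorem annihilator_eq_coordSubspace (hk : k ∈ assocIndices) :
    annihilator K (J4 K k) = coordSubspace K k (annihilatorIndices k) := by
  apply le_antisymm
  · intro x hx i hi
    obtain ⟨j, m, h⟩ := exists_structConst_isolating k hk i hi
    have : (x * J4.e K k j) m = 0 := congrFun (hx (J4.e K k j)) m
    rw [J4.mul_e_apply] at this
    rwa [Finset.sum_eq_single i (fun b _ hb => by simp [h, hb])
      (fun hi => (hi (Finset.mem_univ i)).elim), h, if_pos rfl, Int.cast_one, one_mul] at this
  · intro x hx y
    ext m
    refine Finset.sum_eq_zero fun i _ => Finset.sum_eq_zero fun j _ => ?_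
    by_cases hi : i ∈ annihilatorIndices k
    · have : ∀ j m, structConst k i j m = 0 := by simpa [annihilatorIndices] using hi
      rw [this, Int.cast_zero, zero_mul]
    · rw [hx i hi, zero_mul, mul_zero]

end Coordinates

/-! ### The nine models: nilpotency, associativity, central components, non-isomorphism. -/

section Models

variable {K : Type*} [Field K]

theorem isNilpotentAlg_J4 : ∀ k ∈ assocIndices, IsNilpotentAlg K (J4 K k) := by
  intro k hk
  -- Index 4 is the fifth power; `J_{4,11}`, where `a^4 = d`, needs it.
  refine ⟨4, ?_⟩
  have h4 : ∀ k ∈ assocIndices, lowerIndices k 4 = ∅ := by decide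
  rw [lowerSeries_eq_coordSubspace hk, h4 k hk, coordSubspace_empty]

theorem structConst_assoc : ∀ k ∈ assocIndices, ∀ i j l m : Fin 4,
    ∑ p, structConst k i j p * structConst k p l m =
      ∑ p, structConst k j l p * structConst k i p m := by
  decide

theorem J4.mul_assoc {k : ℕ} (hk : k ∈ assocIndices) (x y z : J4 K k) :
    x * y * z = x * (y * z) := by
  ext m
  have h : ∀ i j l, ∑ p, (structConst k i j p : K) * structConst k p l m =
      ∑ p, (structConst k j l p : K) * structConst k i p m := fun i j l => by
    exact_mod_cast congrArg (Int.cast : ℤ → K) (structConst_assoc k hk i j l m)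
  have hl : (x * y * z) m = ∑ i, ∑ j, ∑ l,
      (∑ p, (structConst k i j p : K) * structConst k p l m) * (x i * y j * z l) := by
    simp only [J4.mul_apply, Fin.sum_univ_four]
    ring
  have hr : (x * (y * z)) m = ∑ i, ∑ j, ∑ l,
      (∑ p, (structConst k j l p : K) * structConst k i p m) * (x i * y j * z l) := by
    simp only [J4.mul_apply, Fin.sum_univ_four]
    ring
  rw [hl, hr]
  simp only [h]

theorem J4.not_assoc {k : ℕ} (hk : k ∈ Finset.Icc 1 13) (hk' : k ∉ assocIndices) :
    ¬ ∀ x y z : J4 K k, x * y * z = x * (y * z) := by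
  -- The two bracketings of a basis triple have a coefficient 1 on one side and 0 on the other,
  -- which stay distinct over any field.
  have key : ∀ k ∈ Finset.Icc 1 13, k ∉ assocIndices → ∃ i j l m : Fin 4,
      ∑ p, structConst k p l m * structConst k i j p = 1 ∧
      ∑ p, structConst k p i m * structConst k j l p = 0 := by
    decide
  obtain ⟨i, j, l, m, h1, h2⟩ := key k hk hk'
  intro h
  have := congrFun (h (J4.e K k i) (J4.e K k j) (J4.e K k l)) m
  rw [mul_comm (J4.e K k i) (J4.e K k j * J4.e K k l), J4.mul_e_apply, J4.mul_e_apply] at this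
  simp only [J4.e_mul_e_apply] at this
  have h1' := congrArg (Int.cast : ℤ → K) h1
  have h2' := congrArg (Int.cast : ℤ → K) h2
  push_cast at h1' h2'
  rw [h1', h2'] at this
  exact one_ne_zero this

theorem hasCentralComponent_J4_iff {k : ℕ} (hk : k ∈ assocIndices) :
    HasCentralComponent K (J4 K k) ↔ k ≤ 4 := by
  constructor
  · contrapose!
    intro h4
    refine not_hasCentralComponent ?_
    rw [annihilator_eq_coordSubspace hk, lowerSeries_eq_coordSubspace hk]
    apply coordSubspace_mono
    revert k
    decide
  · intro h4
    -- For `k ≤ 4` the vector `d` kills everything and occurs in no product, so its line splits off.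
    have h3 : (3 : Fin 4) ∈ annihilatorIndices k := by
      revert k
      decide
    have h3' : (3 : Fin 4) ∉ lowerIndices k 1 := by
      revert k
      decide
    have hann : ∀ x ∈ coordSubspace K k {3}, ∀ y, x * y = 0 := by
      intro x hx
      have := coordSubspace_mono (K := K) (Finset.singleton_subset_iff.2 h3) hx
      rwa [← annihilator_eq_coordSubspace hk] at this
    refine ⟨coordSubspace K k {0, 1, 2}, coordSubspace K k {3}, ?_, ?_, ?_, ?_, hann⟩
    · constructor
      · rw [Submodule.disjoint_def]
        intro x h1 h2
        ext i
        fin_cases i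
        · exact h2 _ (by decide)
        · exact h2 _ (by decide)
        · exact h2 _ (by decide)
        · exact h1 _ (by decide)
      · rw [codisjoint_iff_le_sup, ← coordSubspace_univ]
        refine coordSubspace_le fun i _ => ?_
        fin_cases i
        · exact Submodule.mem_sup_left (e_mem_coordSubspace (by decide))
        · exact Submodule.mem_sup_left (e_mem_coordSubspace (by decide))
        · exact Submodule.mem_sup_left (e_mem_coordSubspace (by decide))
        · exact Submodule.mem_sup_right (e_mem_coordSubspace (by decide))
    · intro h
      have := finrank_coordSubspace (K := K) (k := k) {3}
      rw [h, finrank_bot] at this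
      exact absurd this (by decide)
    · intro x _ y
      have hxy : x * y ∈ lowerSeries K (J4 K k) 1 :=
        Submodule.apply_mem_map₂ (LinearMap.mul K _) (Submodule.mem_top : x ∈ ⊤)
          (Submodule.mem_top : y ∈ ⊤)
      rw [lowerSeries_eq_coordSubspace hk] at hxy
      refine coordSubspace_mono (fun i hi => ?_) hxy
      have key : ∀ i : Fin 4, i ≠ 3 → i ∈ ({0, 1, 2} : Finset (Fin 4)) := by decide
      exact key i fun h => h3' (h ▸ hi)
    · intro x hx y
      rw [hann x hx y]
      exact Submodule.zero_mem _

/-- In `J_{4,12}`, `b^2 = 0` but `a * b ≠ 0`. In `J_{4,13}` the square of `x` is `(x0^2 + x1^2) c +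
2 x0 x1 d`, so square zero forces `x0 = x1 = 0`, that is, `x` in the annihilator. -/
theorem not_isomorphic_J4_twelve_thirteen (h2 : (2 : K) ≠ 0) (e : J4 K 12 ≃ₗ[K] J4 K 13) :
    ¬ ∀ x y, e (x * y) = e x * e y := by
  intro he
  set x := e (J4.e K 12 1)
  have hx : x * x = 0 := by
    rw [← he, ← map_zero e]
    congr 1
    ext m
    rw [J4.e_mul_e_apply]
    revert m
    have : ∀ m, structConst 12 1 1 m = 0 := by decide
    simp [this, J4.zero_apply]
  have h01 : x 0 * x 0 + x 1 * x 1 = 0 := by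
    simpa [J4.mul_apply, Fin.sum_univ_four, structConst, table, J4.zero_apply]
      using congrFun hx 2
  have h01' : x 0 * x 1 + x 1 * x 0 = 0 := by
    simpa [J4.mul_apply, Fin.sum_univ_four, structConst, table, J4.zero_apply]
      using congrFun hx 3
  have hprod : x 0 * x 1 = 0 :=
    (mul_eq_zero.1 (by linear_combination h01' : 2 * (x 0 * x 1) = 0)).resolve_left h2
  have hx0 : x 0 = 0 := by
    rcases mul_eq_zero.1 hprod with h | h
    · exact h
    · simpa [h] using h01
  have hx1 : x 1 = 0 := by simpa [hx0] using h01
  have hmem : x ∈ annihilator K (J4 K 13) := by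
    rw [annihilator_eq_coordSubspace (by decide)]
    intro i hi
    fin_cases i
    · exact hx0
    · exact hx1
    · exact absurd (by decide) hi
    · exact absurd (by decide) hi
  have h := congrArg e.symm (hmem (e (J4.e K 12 0)))
  rw [← he, e.symm_apply_apply, map_zero] at h
  have := congrFun h 3
  rw [J4.e_mul_e_apply, show structConst 12 1 0 3 = 1 by decide] at this
  simp [J4.zero_apply] at this

theorem not_isomorphic_J4 (h2 : (2 : K) ≠ 0) {k l : ℕ} (hk : k ∈ assocIndices)
    (hl : l ∈ assocIndices) (hkl : k ≠ l) : ¬ Isomorphic K (J4 K k) (J4 K l) := by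
  rintro ⟨e, he⟩
  have hlow (n : ℕ) : (lowerIndices k n).card = (lowerIndices l n).card := by
    have := e.finrank_map_eq (lowerSeries K (J4 K k) n)
    rw [map_lowerSeries e he, lowerSeries_eq_coordSubspace hk, lowerSeries_eq_coordSubspace hl,
      finrank_coordSubspace, finrank_coordSubspace] at this
    exact this.symm
  have hann : (annihilatorIndices k).card = (annihilatorIndices l).card := by
    have := e.finrank_map_eq (annihilator K (J4 K k))
    rw [map_annihilator e he, annihilator_eq_coordSubspace hk, annihilator_eq_coordSubspace hl,
      finrank_coordSubspace, finrank_coordSubspace] at this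
    exact this.symm
  have key : ∀ k ∈ assocIndices, ∀ l ∈ assocIndices, k ≠ l →
      (lowerIndices k 1).card = (lowerIndices l 1).card →
      (lowerIndices k 2).card = (lowerIndices l 2).card →
      (annihilatorIndices k).card = (annihilatorIndices l).card →
      (k = 12 ∧ l = 13) ∨ (k = 13 ∧ l = 12) := by
    decide
  rcases key k hk l hl hkl (hlow 1) (hlow 2) hann with ⟨rfl, rfl⟩ | ⟨rfl, rfl⟩
  · exact not_isomorphic_J4_twelve_thirteen h2 e he
  · refine not_isomorphic_J4_twelve_thirteen h2 e.symm fun x y => e.injective ?_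
    simp [he]

end Models

/-! ### The power filtration of a nilpotent associative algebra. -/

section Filtration

variable {K : Type*} [Field K] {A : Type*} [NonUnitalCommRing A] [Module K A]
  [IsScalarTower K A A] [SMulCommClass K A A]

theorem mul_mem_lowerSeries_succ {n : ℕ} {x : A} (hx : x ∈ lowerSeries K A n) (y : A) :
    x * y ∈ lowerSeries K A (n + 1) :=
  Submodule.apply_mem_map₂ (LinearMap.mul K A) hx (Submodule.mem_top : y ∈ ⊤)

theorem mul_mem_lowerSeries_one (x y : A) : x * y ∈ lowerSeries K A 1 :=
  mul_mem_lowerSeries_succ (n := 0) (Submodule.mem_top : x ∈ ⊤) y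

theorem lowerSeries_succ_le {n : ℕ} {P : Submodule K A} :
    lowerSeries K A (n + 1) ≤ P ↔ ∀ x ∈ lowerSeries K A n, ∀ y, x * y ∈ P :=
  Submodule.map₂_le.trans ⟨fun h x hx y => h x hx y Submodule.mem_top, fun h x hx y _ => h x hx y⟩

theorem lowerSeries_succ_le_self (n : ℕ) : lowerSeries K A (n + 1) ≤ lowerSeries K A n := by
  induction n with
  | zero => exact le_top
  | succ n ih => exact lowerSeries_succ_le.2 fun x hx y => mul_mem_lowerSeries_succ (ih hx) y

/-- This is `A^(m+1) * A^(n+1) ⊆ A^(m+n+2)`, with indices shifted by one; associativity enters here.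
-/
theorem mul_mem_lowerSeries {m n : ℕ} {x y : A} (hx : x ∈ lowerSeries K A m)
    (hy : y ∈ lowerSeries K A n) : x * y ∈ lowerSeries K A (m + n + 1) := by
  induction n generalizing x y m with
  | zero => exact mul_mem_lowerSeries_succ hx y
  | succ n ih =>
    have : lowerSeries K A (n + 1) ≤
        (lowerSeries K A (m + (n + 1) + 1)).comap (LinearMap.mul K A x) :=
      lowerSeries_succ_le.2 fun u hu v => by
        change x * (u * v) ∈ lowerSeries K A (m + (n + 1) + 1)
        rw [← mul_assoc]
        exact mul_mem_lowerSeries_succ (ih hx hu) v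
    exact this hy

theorem lowerSeries_eq_of_succ_eq {n : ℕ} (h : lowerSeries K A (n + 1) = lowerSeries K A n)
    (m : ℕ) : lowerSeries K A (n + m) = lowerSeries K A n := by
  induction m with
  | zero => rfl
  | succ m ih =>
    change Submodule.map₂ _ (lowerSeries K A (n + m)) ⊤ = _
    rw [ih]
    exact h

theorem lowerSeries_antitone : Antitone (lowerSeries K A) :=
  antitone_nat_of_succ_le (f := lowerSeries K A) lowerSeries_succ_le_self

/-- A series that stalls once is constant from there on, so nilpotency would force the stalled term
to be zero. -/
theorem finrank_lowerSeries_succ_lt [FiniteDimensional K A] (hnil : IsNilpotentAlg K A) {n : ℕ}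
    (hn : lowerSeries K A n ≠ ⊥) :
    Module.finrank K (lowerSeries K A (n + 1)) < Module.finrank K (lowerSeries K A n) := by
  refine Submodule.finrank_lt_finrank_of_lt
    (lt_of_le_of_ne (lowerSeries_succ_le_self n) fun h => hn ?_)
  obtain ⟨m, hm⟩ := hnil
  rw [eq_bot_iff, ← hm, ← lowerSeries_eq_of_succ_eq h m]
  exact lowerSeries_antitone (Nat.le_add_left m n)

theorem lowerSeries_eq_bot_of_finrank_le [FiniteDimensional K A] (hnil : IsNilpotentAlg K A)
    {n r : ℕ} (h : Module.finrank K (lowerSeries K A n) ≤ r) : lowerSeries K A (n + r) = ⊥ := by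
  induction r generalizing n with
  | zero => exact Submodule.finrank_eq_zero.1 (Nat.le_zero.1 h)
  | succ r ih =>
    by_cases hn : lowerSeries K A n = ⊥
    · exact eq_bot_iff.2 (hn ▸ lowerSeries_antitone (Nat.le_add_right n (r + 1)))
    · have := ih (n := n + 1) (by have := finrank_lowerSeries_succ_lt hnil hn; omega)
      rwa [Nat.add_assoc, Nat.add_comm 1 r] at this

/-- With one generator modulo `A^2`, each successive quotient of powers is spanned by the next power
of that generator. -/
theorem lowerSeries_succ_le_span_sup {n : ℕ} {x p : A}
    (hx : (⊤ : Submodule K A) ≤ Submodule.span K {x} ⊔ lowerSeries K A 1)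
    (hpn : p ∈ lowerSeries K A n)
    (hp : lowerSeries K A n ≤ Submodule.span K {p} ⊔ lowerSeries K A (n + 1)) :
    lowerSeries K A (n + 1) ≤ Submodule.span K {p * x} ⊔ lowerSeries K A (n + 2) := by
  refine lowerSeries_succ_le.2 fun u hu v => ?_
  obtain ⟨_, hp', u', hu', rfl⟩ := Submodule.mem_sup.1 (hp hu)
  obtain ⟨a, rfl⟩ := Submodule.mem_span_singleton.1 hp'
  obtain ⟨_, hx', v', hv', rfl⟩ := Submodule.mem_sup.1 (hx (Submodule.mem_top : v ∈ ⊤))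
  obtain ⟨b, rfl⟩ := Submodule.mem_span_singleton.1 hx'
  rw [add_mul, mul_add, smul_mul_smul_comm, add_assoc]
  refine add_mem (Submodule.mem_sup_left
    (Submodule.smul_mem _ _ (Submodule.mem_span_singleton_self _)))
    (Submodule.mem_sup_right (add_mem ?_ (mul_mem_lowerSeries_succ hu' _)))
  exact mul_mem_lowerSeries (Submodule.smul_mem _ a hpn) hv'

/-- Polarisation: `2xy = (x+y)^2 - x^2 - y^2`. -/
theorem exists_sq_notMem (h2 : (2 : K) ≠ 0) {P : Submodule K A} (h : ¬ lowerSeries K A 1 ≤ P) :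
    ∃ x : A, x * x ∉ P := by
  by_contra! hsq
  refine h (lowerSeries_succ_le.2 fun x _ y => ?_)
  have : (2 : K) • (x * y) ∈ P := by
    have := P.sub_mem (P.sub_mem (hsq (x + y)) (hsq x)) (hsq y)
    convert this using 1
    rw [two_smul, add_mul, mul_add, mul_add, mul_comm y x]
    abel
  exact (P.smul_mem_iff h2).1 this

end Filtration

/-! ### Recognising the models; the cases `dim A^2 = 0, 1, 3`. -/

section Classification

variable {K : Type*} [Field K] {A : Type*} [NonUnitalCommRing A] [Module K A]
  [IsScalarTower K A A] [SMulCommClass K A A]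

theorem Isomorphic.of_span {k : ℕ} (hA : Module.finrank K A = 4) (v : Fin 4 → A)
    (hspan : ⊤ ≤ Submodule.span K (Set.range v))
    (hmul : ∀ i j, v i * v j = ∑ m, (structConst k i j m : K) • v m) :
    Isomorphic K A (J4 K k) := by
  have hcard : Fintype.card (Fin 4) = Module.finrank K A := by rw [hA, Fintype.card_fin]
  let b := basisOfTopLeSpanOfCardEqFinrank v hspan hcard
  have hb : ∀ i, b i = v i := fun i => by
    rw [coe_basisOfTopLeSpanOfCardEqFinrank]
  let e : A ≃ₗ[K] J4 K k := b.equivFun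
  have hsymm : ∀ x : J4 K k, e.symm x = ∑ i, x i • v i := fun x => by
    simp only [← hb]
    exact b.equivFun_symm_apply x
  have hinv : ∀ x y : J4 K k, e.symm (x * y) = e.symm x * e.symm y := by
    intro x y
    simp only [hsymm, Finset.sum_mul_sum, smul_mul_smul_comm, hmul, J4.mul_apply, Finset.sum_smul,
      Finset.smul_sum]
    rw [Finset.sum_comm]
    refine Finset.sum_congr rfl fun i _ => ?_
    rw [Finset.sum_comm]
    refine Finset.sum_congr rfl fun j _ => Finset.sum_congr rfl fun m _ => ?_
    rw [smul_smul, mul_comm]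
  exact ⟨e, fun x y => e.symm.injective (by simp [hinv])⟩

theorem isomorphic_of_products {k : ℕ} (hA : Module.finrank K A = 4) (a b c d : A)
    (hspan : ∀ x : A, ∃ r s t u : K, x = r • a + s • b + t • c + u • d)
    (hmul : ∀ i j, ![a, b, c, d] i * ![a, b, c, d] j =
      ∑ m, (structConst k i j m : K) • ![a, b, c, d] m) :
    Isomorphic K A (J4 K k) := by
  refine Isomorphic.of_span hA ![a, b, c, d] (fun x _ => ?_) hmul
  obtain ⟨r, s, t, u, h⟩ := hspan x
  have hsum : x = ∑ i, ![r, s, t, u] i • ![a, b, c, d] i := by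
    rw [h, Fin.sum_univ_four]
    rfl
  rw [hsum]
  exact Submodule.sum_mem _ fun i _ => Submodule.smul_mem _ _ (Submodule.subset_span ⟨i, rfl⟩)

theorem isomorphic_one (hA : Module.finrank K A = 4) (h : lowerSeries K A 1 = ⊥) :
    Isomorphic K A (J4 K 1) := by
  have : FiniteDimensional K A := Module.finite_of_finrank_eq_succ hA
  let b := (Module.finBasis K A).reindex (finCongr hA)
  refine Isomorphic.of_span hA b b.span_eq.ge fun i j => ?_
  have : b i * b j ∈ lowerSeries K A 1 := mul_mem_lowerSeries_one _ _
  rw [h, Submodule.mem_bot] at this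
  simp [this, structConst, table]

theorem isomorphic_eleven (hA : Module.finrank K A = 4) (hnil : IsNilpotentAlg K A)
    (h : Module.finrank K (lowerSeries K A 1) = 3) : Isomorphic K A (J4 K 11) := by
  have : FiniteDimensional K A := Module.finite_of_finrank_eq_succ hA
  have h4 : lowerSeries K A 4 = ⊥ := lowerSeries_eq_bot_of_finrank_le hnil (n := 1) (r := 3) h.le
  have hne : lowerSeries K A 1 ≠ ⊤ := fun ht => by
    rw [ht, finrank_top, hA] at h
    omega
  obtain ⟨x, -, hx⟩ := SetLike.exists_of_lt hne.lt_top
  have htop : (⊤ : Submodule K A) ≤ Submodule.span K {x} ⊔ lowerSeries K A 1 := by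
    refine (Submodule.eq_top_of_finrank_eq ?_).ge
    have hlt : lowerSeries K A 1 < Submodule.span K {x} ⊔ lowerSeries K A 1 :=
      lt_of_le_of_ne le_sup_right fun he =>
        hx (he ▸ Submodule.mem_sup_left (Submodule.mem_span_singleton_self x))
    have h1 := Submodule.finrank_lt_finrank_of_lt hlt
    have h2 := Submodule.finrank_le (Submodule.span K {x} ⊔ lowerSeries K A 1)
    omega
  have m0 : x ∈ lowerSeries K A 0 := Submodule.mem_top
  have m1 := mul_mem_lowerSeries_succ m0 x
  have m2 := mul_mem_lowerSeries_succ m1 x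
  have m3 := mul_mem_lowerSeries_succ m2 x
  have s1 := lowerSeries_succ_le_span_sup htop m0 htop
  have s2 := lowerSeries_succ_le_span_sup htop m1 s1
  have s3 := lowerSeries_succ_le_span_sup htop m2 s2
  rw [show 0 + 1 + 1 + 2 = 4 from rfl, h4, sup_bot_eq] at s3
  have hz (y : A) : x * x * x * x * y = 0 := by
    have := mul_mem_lowerSeries_succ m3 y
    rwa [show 0 + 1 + 1 + 1 + 1 = 4 from rfl, h4, Submodule.mem_bot] at this
  refine isomorphic_of_products hA x (x * x) (x * x * x) (x * x * x * x) (fun y => ?_) ?_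
  · obtain ⟨_, h1, y1, hy1, rfl⟩ := Submodule.mem_sup.1 (htop (Submodule.mem_top : y ∈ ⊤))
    obtain ⟨_, h2, y2, hy2, rfl⟩ := Submodule.mem_sup.1 (s1 hy1)
    obtain ⟨_, h3, y3, hy3, rfl⟩ := Submodule.mem_sup.1 (s2 hy2)
    obtain ⟨r, rfl⟩ := Submodule.mem_span_singleton.1 h1
    obtain ⟨s, rfl⟩ := Submodule.mem_span_singleton.1 h2
    obtain ⟨t, rfl⟩ := Submodule.mem_span_singleton.1 h3
    obtain ⟨u, rfl⟩ := Submodule.mem_span_singleton.1 (s3 hy3)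
    exact ⟨r, s, t, u, by simp only [add_assoc]⟩
  · have hz' := hz
    simp only [mul_assoc] at hz'
    intro i j
    fin_cases i <;> fin_cases j <;>
      simp [structConst, table, mul_assoc, hz']

theorem isomorphic_two_of_diagonal (hA : Module.finrank K A = 4) {u v w z : A}
    (hspan : ∀ x : A, ∃ r s t q : K, x = r • u + s • v + t • w + q • z)
    (hz : ∀ x, z * x = 0) (huv : u * v = 0) (huw : u * w = 0) (hvw : v * w = 0)
    (hu : u * u = z) (hv : v * v = 0) (hw : w * w = 0) : Isomorphic K A (J4 K 2) := by
  have hz' : ∀ x, x * z = 0 := fun x => by rw [mul_comm, hz]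
  refine isomorphic_of_products hA u z v w (fun x => ?_) fun i j => ?_
  · obtain ⟨r, s, t, q, rfl⟩ := hspan x
    exact ⟨r, q, s, t, by abel⟩
  · fin_cases i <;> fin_cases j <;>
      simp [structConst, table, hz, hz', huv, huw, hvw, hu, hv, hw, mul_comm v u, mul_comm w u,
        mul_comm w v]

theorem isomorphic_three_of_diagonal (hA : Module.finrank K A = 4) {u v w z : A}
    (hspan : ∀ x : A, ∃ r s t q : K, x = r • u + s • v + t • w + q • z)
    (hz : ∀ x, z * x = 0) (huv : u * v = 0) (huw : u * w = 0) (hvw : v * w = 0)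
    (hu : u * u = z) (hv : v * v = z) (hw : w * w = 0) : Isomorphic K A (J4 K 3) := by
  have hz' : ∀ x, x * z = 0 := fun x => by rw [mul_comm, hz]
  refine isomorphic_of_products hA u v z w (fun x => ?_) fun i j => ?_
  · obtain ⟨r, s, t, q, rfl⟩ := hspan x
    exact ⟨r, s, q, t, by abel⟩
  · fin_cases i <;> fin_cases j <;>
      simp [structConst, table, hz, hz', huv, huw, hvw, hu, hv, hw, mul_comm v u, mul_comm w u,
        mul_comm w v]

theorem isomorphic_five_of_diagonal (hA : Module.finrank K A = 4) {u v w z : A}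
    (hspan : ∀ x : A, ∃ r s t q : K, x = r • u + s • v + t • w + q • z)
    (hz : ∀ x, z * x = 0) (huv : u * v = 0) (huw : u * w = 0) (hvw : v * w = 0)
    (hu : u * u = z) (hv : v * v = z) (hw : w * w = z) : Isomorphic K A (J4 K 5) := by
  have hz' : ∀ x, x * z = 0 := fun x => by rw [mul_comm, hz]
  refine isomorphic_of_products hA u v w z hspan fun i j => ?_
  fin_cases i <;> fin_cases j <;>
    simp [structConst, table, hz, hz', huv, huw, hvw, hu, hv, hw, mul_comm v u, mul_comm w u,
      mul_comm w v]

/-- Up to permuting `u, v, w`, only the number of nonzero squares matters: 3, 2, 1, 0 give the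
models 5, 3, 2, 1. -/
theorem exists_isomorphic_of_diagonal (hA : Module.finrank K A = 4) {u v w z : A}
    (hspan : ∀ x : A, ∃ r s t q : K, x = r • u + s • v + t • w + q • z)
    (hz : ∀ x, z * x = 0) (huv : u * v = 0) (huw : u * w = 0) (hvw : v * w = 0)
    (hu : u * u = z ∨ u * u = 0) (hv : v * v = z ∨ v * v = 0) (hw : w * w = z ∨ w * w = 0) :
    ∃ k ∈ assocIndices, Isomorphic K A (J4 K k) := by
  have hvu : v * u = 0 := by rw [mul_comm, huv]
  have hwu : w * u = 0 := by rw [mul_comm, huw]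
  have hwv : w * v = 0 := by rw [mul_comm, hvw]
  have hspan' {u' v' w' : A} (h : ∀ r s t q : K, ∃ r' s' t' q' : K,
      r • u + s • v + t • w + q • z = r' • u' + s' • v' + t' • w' + q' • z) (x : A) :
      ∃ r s t q : K, x = r • u' + s • v' + t • w' + q • z := by
    obtain ⟨r, s, t, q, rfl⟩ := hspan x
    exact h r s t q
  rcases hu with hu | hu <;> rcases hv with hv | hv <;> rcases hw with hw | hw
  · exact ⟨5, by decide, isomorphic_five_of_diagonal hA hspan hz huv huw hvw hu hv hw⟩
  · exact ⟨3, by decide, isomorphic_three_of_diagonal hA hspan hz huv huw hvw hu hv hw⟩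
  · exact ⟨3, by decide, isomorphic_three_of_diagonal hA
      (hspan' fun r s t q => ⟨r, t, s, q, by abel⟩) hz huw huv hwv hu hw hv⟩
  · exact ⟨2, by decide, isomorphic_two_of_diagonal hA hspan hz huv huw hvw hu hv hw⟩
  · exact ⟨3, by decide, isomorphic_three_of_diagonal hA
      (hspan' fun r s t q => ⟨s, t, r, q, by abel⟩) hz hvw hvu hwu hv hw hu⟩
  · exact ⟨2, by decide, isomorphic_two_of_diagonal hA
      (hspan' fun r s t q => ⟨s, t, r, q, by abel⟩) hz hvw hvu hwu hv hw hu⟩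
  · exact ⟨2, by decide, isomorphic_two_of_diagonal hA
      (hspan' fun r s t q => ⟨t, r, s, q, by abel⟩) hz hwu hwv huv hw hu hv⟩
  · refine ⟨1, by decide, isomorphic_one hA (le_bot_iff.1 (lowerSeries_succ_le.2 fun x _ y => ?_))⟩
    obtain ⟨r, s, t, q, rfl⟩ := hspan x
    obtain ⟨r', s', t', q', rfl⟩ := hspan y
    have hz' : ∀ x, x * z = 0 := fun x => by rw [mul_comm, hz]
    simp [add_mul, mul_add, smul_mul_smul_comm, hz, hz', huv, hvu, huw, hwu, hvw, hwv, hu, hv, hw]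

/-- The scalar is the inverse of a square root of `c`, or 1 when `c = 0`. -/
theorem exists_smul_sq_eq [IsAlgClosed K] (x z : A) (c : K) (h : x * x = c • z) :
    ∃ s : K, s ≠ 0 ∧ ((s • x) * (s • x) = z ∨ (s • x) * (s • x) = 0) := by
  by_cases hc : c = 0
  · exact ⟨1, one_ne_zero, Or.inr (by rw [one_smul, h, hc, zero_smul])⟩
  · obtain ⟨t, rfl⟩ := IsAlgClosed.exists_eq_mul_self c
    have ht : t ≠ 0 := fun h => hc (by rw [h, zero_mul])
    refine ⟨t⁻¹, inv_ne_zero ht, Or.inl ?_⟩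
    rw [smul_mul_smul_comm, h, smul_smul, mul_mul_mul_comm, inv_mul_cancel₀ ht, one_mul, one_smul]

theorem exists_isomorphic_of_finrank_one [IsAlgClosed K] (h2 : (2 : K) ≠ 0)
    (hA : Module.finrank K A = 4) (hnil : IsNilpotentAlg K A)
    (h : Module.finrank K (lowerSeries K A 1) = 1) :
    ∃ k ∈ assocIndices, Isomorphic K A (J4 K k) := by
  have : FiniteDimensional K A := Module.finite_of_finrank_eq_succ hA
  have hL2 : lowerSeries K A 2 = ⊥ := lowerSeries_eq_bot_of_finrank_le hnil (n := 1) (r := 1) h.le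
  obtain ⟨⟨z, hzL⟩, hz0, hzspan⟩ := finrank_eq_one_iff'.1 h
  have hz0 : z ≠ 0 := fun h => hz0 (Subtype.ext h)
  have hzspan : ∀ w ∈ lowerSeries K A 1, ∃ c : K, w = c • z := fun w hw => by
    obtain ⟨c, hc⟩ := hzspan ⟨w, hw⟩
    exact ⟨c, (congrArg Subtype.val hc).symm⟩
  have hz : ∀ x, z * x = 0 := fun x => by
    have := mul_mem_lowerSeries_succ hzL x
    rwa [hL2, Submodule.mem_bot] at this
  obtain ⟨f, hf⟩ : ∃ f : Module.Dual K A, f z = 1 := by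
    obtain ⟨g, hg⟩ := not_forall.1 (mt (Module.forall_dual_apply_eq_zero_iff K z).1 hz0)
    exact ⟨(g z)⁻¹ • g, inv_mul_cancel₀ hg⟩
  have hmul (x y : A) : x * y = f (x * y) • z := by
    obtain ⟨c, hc⟩ := hzspan _ (mul_mem_lowerSeries_one (K := K) x y)
    rw [hc, map_smul, hf, smul_eq_mul, mul_one]
  obtain ⟨V, hV⟩ := (lowerSeries K A 1).exists_isCompl
  have hV3 : Module.finrank K V = 3 := by
    have := Submodule.finrank_add_eq_of_isCompl hV
    omega
  have : Invertible (2 : K) := invertibleOfNonzero h2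
  -- As `A^2` is the line of `z` and `f z = 1`, the product is `f (x * y) • z`; an orthogonal basis
  -- of this form exists because 2 is invertible.
  let B : LinearMap.BilinForm K V :=
    ((LinearMap.mul K A).compr₂ f).compl₁₂ V.subtype V.subtype
  have hB : LinearMap.IsSymm B := ⟨fun x y => congrArg f (mul_comm (x : A) y)⟩
  obtain ⟨b', hb'⟩ := LinearMap.BilinForm.exists_orthogonal_basis hB
  let b := b'.reindex (finCongr hV3)
  have hb (i j : Fin 3) (hij : i ≠ j) : (b i : A) * b j = 0 := by
    have : f ((b i : A) * b j) = 0 := by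
      simpa [b, B] using hb' (fun h => hij (by simpa using h) :
        (finCongr hV3).symm i ≠ (finCongr hV3).symm j)
    rw [hmul, this, zero_smul]
  obtain ⟨s0, hs0, h0⟩ := exists_smul_sq_eq _ _ _ (hmul (b 0 : A) (b 0))
  obtain ⟨s1, hs1, h1⟩ := exists_smul_sq_eq _ _ _ (hmul (b 1 : A) (b 1))
  obtain ⟨s2, hs2, h2⟩ := exists_smul_sq_eq _ _ _ (hmul (b 2 : A) (b 2))
  refine exists_isomorphic_of_diagonal hA (u := s0 • (b 0 : A)) (v := s1 • (b 1 : A))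
    (w := s2 • (b 2 : A)) (fun x => ?_) hz ?_ ?_ ?_ h0 h1 h2
  · obtain ⟨l, hl, v, hv, rfl⟩ := Submodule.mem_sup.1
      (hV.sup_eq_top ▸ Submodule.mem_top : x ∈ lowerSeries K A 1 ⊔ V)
    obtain ⟨c, rfl⟩ := hzspan l hl
    have := congrArg Subtype.val (b.sum_repr ⟨v, hv⟩)
    rw [Fin.sum_univ_three] at this
    refine ⟨b.repr ⟨v, hv⟩ 0 * s0⁻¹, b.repr ⟨v, hv⟩ 1 * s1⁻¹, b.repr ⟨v, hv⟩ 2 * s2⁻¹, c, ?_⟩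
    rw [smul_smul, smul_smul, smul_smul, inv_mul_cancel_right₀ hs0, inv_mul_cancel_right₀ hs1,
      inv_mul_cancel_right₀ hs2, add_comm]
    exact congrArg (· + c • z) this.symm
  · rw [smul_mul_smul_comm, hb 0 1 (by decide), smul_zero]
  · rw [smul_mul_smul_comm, hb 0 2 (by decide), smul_zero]
  · rw [smul_mul_smul_comm, hb 1 2 (by decide), smul_zero]

end Classification

/-! ### Generators modulo a plane and linear relations inside it. -/

section LinearAlgebra

variable {K : Type*} [Field K] {A : Type*} [AddCommGroup A] [Module K A]

theorem exists_top_le_span_pair_sup (hA : Module.finrank K A = 4)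
    {P : Submodule K A} (hP : Module.finrank K P = 2) {x : A} (hx : x ∉ P) :
    ∃ y, ⊤ ≤ Submodule.span K {x, y} ⊔ P := by
  have : FiniteDimensional K A := Module.finite_of_finrank_eq_succ hA
  have h3 := Submodule.finrank_sup_span_singleton hx
  obtain ⟨y, -, hy⟩ := SetLike.exists_of_lt
    (lt_top_iff_ne_top.2 (fun h => by rw [h, finrank_top] at h3; omega :
      P ⊔ Submodule.span K {x} ≠ ⊤))
  have h4 := Submodule.finrank_sup_span_singleton hy
  refine ⟨y, (Submodule.eq_top_of_finrank_eq ?_).ge⟩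
  rw [Submodule.span_insert, sup_comm, ← sup_assoc, h4, h3, hP, hA]

theorem exists_eq_of_top_le_span_pair_sup {P : Submodule K A} {x y : A}
    (h : ⊤ ≤ Submodule.span K {x, y} ⊔ P) (w : A) :
    ∃ a b : K, ∃ l ∈ P, w = a • x + b • y + l := by
  obtain ⟨v, hv, l, hl, rfl⟩ := Submodule.mem_sup.1 (h (Submodule.mem_top : w ∈ ⊤))
  obtain ⟨a, b, rfl⟩ := Submodule.mem_span_pair.1 hv
  exact ⟨a, b, l, hl, rfl⟩

theorem exists_relation_of_finrank_eq_two {P : Submodule K A} [FiniteDimensional K A]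
    (hP : Module.finrank K P = 2) {x y z : A} (hx : x ∈ P) (hy : y ∈ P) (hz : z ∈ P) :
    ∃ a b c : K, a • x + b • y + c • z = 0 ∧ (a ≠ 0 ∨ b ≠ 0 ∨ c ≠ 0) := by
  let v : Fin 3 → P := ![⟨x, hx⟩, ⟨y, hy⟩, ⟨z, hz⟩]
  have hv : ¬ LinearIndependent K v := fun h => by
    have := h.fintype_card_le_finrank
    rw [hP, Fintype.card_fin] at this
    omega
  obtain ⟨g, hg, i, hi⟩ := Fintype.not_linearIndependent_iff.1 hv
  refine ⟨g 0, g 1, g 2, ?_, ?_⟩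
  · rw [Fin.sum_univ_three] at hg
    exact congrArg Subtype.val hg
  · fin_cases i
    · exact Or.inl hi
    · exact Or.inr (Or.inl hi)
    · exact Or.inr (Or.inr hi)

theorem top_le_span_pair_sup_of_mem {P : Submodule K A} {u v p q : A}
    (h : ⊤ ≤ Submodule.span K {u, v} ⊔ P) (hu : u ∈ Submodule.span K {p, q})
    (hv : v ∈ Submodule.span K {p, q}) : ⊤ ≤ Submodule.span K {p, q} ⊔ P :=
  h.trans (sup_le_sup_right
    (Submodule.span_le.2 (Set.insert_subset hu (Set.singleton_subset_iff.2 hv))) P)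

end LinearAlgebra

/-! ### The case `dim A^2 = 2`. -/

section Classification

variable {K : Type*} [Field K] {A : Type*} [NonUnitalCommRing A] [Module K A]
  [IsScalarTower K A A] [SMulCommClass K A A]

theorem exists_eq_of_mem_lowerSeries_one (hL2 : lowerSeries K A 2 = ⊥) {u v : A}
    (h : ⊤ ≤ Submodule.span K {u, v} ⊔ lowerSeries K A 1) {w : A} (hw : w ∈ lowerSeries K A 1) :
    ∃ a b c : K, w = a • (u * u) + b • (u * v) + c • (v * v) := by
  have hL (x : A) (hx : x ∈ lowerSeries K A 1) (y : A) : x * y = 0 := by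
    have := mul_mem_lowerSeries_succ hx y
    rwa [hL2, Submodule.mem_bot] at this
  have hle : lowerSeries K A 1 ≤ Submodule.span K {u * u, u * v, v * v} := by
    refine lowerSeries_succ_le.2 fun x _ y => ?_
    obtain ⟨a, b, l, hl, rfl⟩ := exists_eq_of_top_le_span_pair_sup h x
    obtain ⟨a', b', l', hl', rfl⟩ := exists_eq_of_top_le_span_pair_sup h y
    refine Submodule.mem_span_triple.2 ⟨a * a', a * b' + b * a', b * b', ?_⟩
    rw [add_mul, hL l hl, add_zero, mul_add, mul_comm _ l', hL l' hl', add_zero]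
    simp only [add_mul, mul_add, smul_mul_smul_comm, mul_comm v u, add_smul]
    abel
  obtain ⟨a, b, c, h⟩ := Submodule.mem_span_triple.1 (hle hw)
  exact ⟨a, b, c, h.symm⟩

theorem isomorphic_twelve (hA : Module.finrank K A = 4) (hL2 : lowerSeries K A 2 = ⊥) {p q : A}
    (h : ⊤ ≤ Submodule.span K {p, q} ⊔ lowerSeries K A 1) (hp : p * p = 0) :
    Isomorphic K A (J4 K 12) := by
  have hz (x y z : A) : x * (y * z) = 0 := by
    have := mul_mem_lowerSeries_succ (mul_mem_lowerSeries_one (K := K) y z) x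
    rwa [hL2, Submodule.mem_bot, mul_comm] at this
  refine isomorphic_of_products hA q p (q * q) (q * p) (fun x => ?_) fun i j => ?_
  · obtain ⟨a, b, l, hl, rfl⟩ := exists_eq_of_top_le_span_pair_sup h x
    obtain ⟨r, s, t, rfl⟩ := exists_eq_of_mem_lowerSeries_one hL2 h hl
    exact ⟨b, a, t, s, by rw [hp, mul_comm q p, smul_zero]; abel⟩
  · fin_cases i <;> fin_cases j <;>
      simp [structConst, table, mul_assoc, hz, hp, mul_comm p q]

/-- Since `p * q = 0`, the elements `p + q` and `p - q` have the same square `p^2 + q^2` and product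
`p^2 - q^2`. Division by 2 recovers `p` and `q`. -/
theorem isomorphic_thirteen (h2 : (2 : K) ≠ 0) (hA : Module.finrank K A = 4)
    (hL2 : lowerSeries K A 2 = ⊥) {p q : A}
    (h : ⊤ ≤ Submodule.span K {p, q} ⊔ lowerSeries K A 1) (hpq : p * q = 0) :
    Isomorphic K A (J4 K 13) := by
  have hz (x y z : A) : x * (y * z) = 0 := by
    have := mul_mem_lowerSeries_succ (mul_mem_lowerSeries_one (K := K) y z) x
    rwa [hL2, Submodule.mem_bot, mul_comm] at this
  have hqp : q * p = 0 := by rw [mul_comm, hpq]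
  have key (a b : K) (x y : A) :
      a • x + b • y = ((a + b) / 2) • (x + y) + ((a - b) / 2) • (x - y) := by
    match_scalars <;> field_simp <;> ring
  refine isomorphic_of_products hA (p + q) (p - q) (p * p + q * q) (p * p - q * q)
    (fun x => ?_) fun i j => ?_
  · obtain ⟨a, b, l, hl, rfl⟩ := exists_eq_of_top_le_span_pair_sup h x
    obtain ⟨r, s, t, rfl⟩ := exists_eq_of_mem_lowerSeries_one hL2 h hl
    refine ⟨(a + b) / 2, (a - b) / 2, (r + t) / 2, (r - t) / 2, ?_⟩
    rw [hpq, smul_zero, add_zero, key a b, key r t, ← add_assoc]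
  · fin_cases i <;> fin_cases j <;>
      simp [structConst, table, mul_assoc, hz, hpq, hqp, mul_add, add_mul, sub_eq_add_neg]

theorem exists_isomorphic_of_square_eq_bot [IsAlgClosed K] (h2 : (2 : K) ≠ 0)
    (hA : Module.finrank K A = 4) (h : Module.finrank K (lowerSeries K A 1) = 2)
    (hL2 : lowerSeries K A 2 = ⊥) : ∃ k ∈ assocIndices, Isomorphic K A (J4 K k) := by
  have : FiniteDimensional K A := Module.finite_of_finrank_eq_succ hA
  obtain ⟨u, -, hu⟩ := SetLike.exists_of_lt
    (lt_top_iff_ne_top.2 (fun ht => by rw [ht, finrank_top] at h; omega :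
      lowerSeries K A 1 ≠ ⊤))
  obtain ⟨v, huv⟩ := exists_top_le_span_pair_sup hA h hu
  obtain ⟨a, b, c, hrel, hne⟩ := exists_relation_of_finrank_eq_two h
    (mul_mem_lowerSeries_one u u) (mul_mem_lowerSeries_one u v) (mul_mem_lowerSeries_one v v)
  by_cases ha : a = 0
  · rw [ha, zero_smul, zero_add] at hrel
    by_cases hb : b = 0
    · have hc : c ≠ 0 := by simpa [ha, hb] using hne
      rw [hb, zero_smul, zero_add] at hrel
      rw [Set.pair_comm] at huv
      exact ⟨12, by decide, isomorphic_twelve hA hL2 huv ((smul_eq_zero.1 hrel).resolve_left hc)⟩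
    · refine ⟨13, by decide, isomorphic_thirteen h2 hA hL2 (p := v) (q := b • u + c • v)
        (top_le_span_pair_sup_of_mem huv (Submodule.mem_span_pair.2 ⟨-(b⁻¹ * c), b⁻¹, ?_⟩)
          (Submodule.subset_span (by simp))) ?_⟩
      · match_scalars <;> field_simp; ring
      · rw [mul_add, mul_smul_comm, mul_smul_comm, mul_comm v u, hrel]
  · have : NeZero (2 : K) := ⟨h2⟩
    -- With `t, s` the two roots, the relation becomes `a (u - t v)(u - s v) = 0`; a double root
    -- leads to 12, distinct roots to 13.
    obtain ⟨t, ht⟩ := exists_quadratic_eq_zero (a := a) (b := b) (c := c) ha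
      (IsAlgClosed.exists_eq_mul_self _)
    obtain ⟨s, hs⟩ : ∃ s, b = -a * (t + s) := ⟨-b / a - t, by field_simp; ring⟩
    have hc : c = a * (t * s) := by linear_combination ht - t * hs
    have hprod : (u - t • v) * (u - s • v) = 0 := by
      have : a • ((u - t • v) * (u - s • v)) = 0 := by
        rw [← hrel, hc, hs]
        simp only [sub_mul, mul_sub, smul_mul_assoc, mul_smul_comm, mul_comm v u]
        module
      exact (smul_eq_zero.1 this).resolve_left ha
    by_cases hst : s = t
    · rw [hst] at hprod
      refine ⟨12, by decide, isomorphic_twelve hA hL2 (p := u - t • v) (q := v)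
        (top_le_span_pair_sup_of_mem huv (Submodule.mem_span_pair.2 ⟨1, t, by module⟩)
          (Submodule.subset_span (by simp))) hprod⟩
    · have hst' : s - t ≠ 0 := sub_ne_zero.2 hst
      refine ⟨13, by decide, isomorphic_thirteen h2 hA hL2 (p := u - t • v) (q := u - s • v)
        (top_le_span_pair_sup_of_mem huv
          (Submodule.mem_span_pair.2 ⟨s / (s - t), -t / (s - t), ?_⟩)
          (Submodule.mem_span_pair.2 ⟨1 / (s - t), -1 / (s - t), ?_⟩)) hprod⟩
      -- With `p = u - t v` and `q = u - s v`: `s p - t q = (s - t) u` and `p - q = (s - t) v`.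
      · match_scalars <;> field_simp <;> ring
      · match_scalars <;> field_simp <;> ring

theorem exists_generators_of_square_ne_bot (h2 : (2 : K) ≠ 0)
    (hA : Module.finrank K A = 4) (hnil : IsNilpotentAlg K A)
    (h : Module.finrank K (lowerSeries K A 1) = 2) (hL2 : lowerSeries K A 2 ≠ ⊥) :
    ∃ x y : A, lowerSeries K A 1 ≤ Submodule.span K {x * x, x * (x * x)} ∧
      ⊤ ≤ Submodule.span K {x, y} ⊔ lowerSeries K A 1 ∧ x * (x * x) ≠ 0 ∧
      ∀ w, x * (x * (x * w)) = 0 := by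
  have : FiniteDimensional K A := Module.finite_of_finrank_eq_succ hA
  have hL3 : lowerSeries K A 3 = ⊥ := lowerSeries_eq_bot_of_finrank_le hnil (n := 1) (r := 2) h.le
  have hne : lowerSeries K A 1 ≠ ⊥ := fun hbot => by
    rw [hbot, finrank_bot] at h
    omega
  have hlt : Module.finrank K (lowerSeries K A 2) < Module.finrank K (lowerSeries K A 1) :=
    finrank_lowerSeries_succ_lt hnil hne
  have h1 : Module.finrank K (lowerSeries K A 2) = 1 := by
    have : Module.finrank K (lowerSeries K A 2) ≠ 0 := mt Submodule.finrank_eq_zero.1 hL2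
    omega
  have hz2 {x : A} (hx : x ∈ lowerSeries K A 2) (y : A) : x * y = 0 := by
    have := mul_mem_lowerSeries_succ hx y
    rwa [hL3, Submodule.mem_bot] at this
  have hz1 {x y : A} (hx : x ∈ lowerSeries K A 1) (hy : y ∈ lowerSeries K A 1) : x * y = 0 := by
    have := mul_mem_lowerSeries hx hy
    rwa [hL3, Submodule.mem_bot] at this
  obtain ⟨x, hx⟩ := exists_sq_notMem (A := A) h2 (P := lowerSeries K A 2) fun hle => by
    have := Submodule.finrank_mono hle
    omega
  have hL1 : ∀ w ∈ lowerSeries K A 1, ∃ c : K, ∃ l ∈ lowerSeries K A 2, w = c • (x * x) + l := by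
    have heq : lowerSeries K A 2 ⊔ Submodule.span K {x * x} = lowerSeries K A 1 := by
      refine Submodule.eq_of_le_of_finrank_eq (sup_le (lowerSeries_succ_le_self 1) ?_) ?_
      · rw [Submodule.span_singleton_le_iff_mem]
        exact mul_mem_lowerSeries_one x x
      · rw [Submodule.finrank_sup_span_singleton hx, h1, h]
    intro w hw
    obtain ⟨l, hl, _, hw', rfl⟩ := Submodule.mem_sup.1 (heq.symm ▸ hw)
    obtain ⟨c, rfl⟩ := Submodule.mem_span_singleton.1 hw'
    exact ⟨c, l, hl, add_comm _ _⟩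
  -- Modulo `A^3`, `A^2` is spanned by `x^2`; since `A^4 = 0`, every product in `A^2 * A` is a
  -- multiple of `x^3`, so `x^3 = 0` would give `A^3 = 0`.
  have hx3 : x * (x * x) ≠ 0 := by
    intro h0
    refine hL2 (le_bot_iff.1 (lowerSeries_succ_le.2 fun w hw y => ?_))
    obtain ⟨c, l, hl, rfl⟩ := hL1 w hw
    obtain ⟨c', l', hl', hxy⟩ := hL1 (x * y) (mul_mem_lowerSeries_one x y)
    rw [Submodule.mem_bot, add_mul, hz2 hl, add_zero, smul_mul_assoc, mul_assoc, hxy, mul_add,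
      mul_smul_comm, h0, mul_comm x l', hz2 hl', smul_zero, add_zero, smul_zero]
  have hx3mem : x * (x * x) ∈ lowerSeries K A 2 := by
    rw [← mul_assoc]
    exact mul_mem_lowerSeries_succ (mul_mem_lowerSeries_one x x) x
  have hx1 : x ∉ lowerSeries K A 1 := fun hx1 => hx (by rw [hz1 hx1 hx1]; exact zero_mem _)
  obtain ⟨y, hy⟩ := exists_top_le_span_pair_sup hA h hx1
  refine ⟨x, y, fun w hw => ?_, hy, hx3, fun w => ?_⟩
  · obtain ⟨c, l, hl, rfl⟩ := hL1 w hw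
    obtain ⟨s, hs⟩ := (finrank_eq_one_iff_of_nonzero' (⟨_, hx3mem⟩ : lowerSeries K A 2)
      fun h0 => hx3 (congrArg Subtype.val h0)).1 h1 ⟨l, hl⟩
    exact Submodule.mem_span_pair.2 ⟨c, s, congrArg (c • (x * x) + ·) (congrArg Subtype.val hs)⟩
  · rw [← mul_assoc, ← mul_assoc, mul_assoc x x x]
    exact hz2 hx3mem w

theorem exists_isomorphic_of_square_ne_bot [IsAlgClosed K] (h2 : (2 : K) ≠ 0)
    (hA : Module.finrank K A = 4) (hnil : IsNilpotentAlg K A)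
    (h : Module.finrank K (lowerSeries K A 1) = 2) (hL2 : lowerSeries K A 2 ≠ ⊥) :
    ∃ k ∈ assocIndices, Isomorphic K A (J4 K k) := by
  obtain ⟨x, y', hle, hy', hx3, hx4⟩ := exists_generators_of_square_ne_bot h2 hA hnil h hL2
  have hL1' : ∀ w ∈ lowerSeries K A 1, ∃ r s : K, w = r • (x * x) + s • (x * (x * x)) := by
    intro w hw
    obtain ⟨r, s, hrs⟩ := Submodule.mem_span_pair.1 (hle hw)
    exact ⟨r, s, hrs.symm⟩
  obtain ⟨a, b, hab⟩ := hL1' (x * y') (mul_mem_lowerSeries_one x y')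
  -- The correction cancels `x * y' = a x^2 + b x^3`.
  obtain ⟨y, hy⟩ : ∃ y, y = y' - a • x - b • (x * x) := ⟨_, rfl⟩
  have hxy : x * y = 0 := by
    rw [hy, mul_sub, mul_sub, hab, mul_smul_comm, mul_smul_comm]
    abel
  have hspan (w : A) : ∃ r s t q : K, w = r • x + s • (x * x) + t • (x * (x * x)) + q • y := by
    obtain ⟨r, s, l, hl, rfl⟩ := exists_eq_of_top_le_span_pair_sup hy' w
    obtain ⟨t, q, rfl⟩ := hL1' l hl
    exact ⟨r + s * a, t + s * b, q, s, by rw [hy]; module⟩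
  obtain ⟨c, d, hcd⟩ := hL1' (y * y) (mul_mem_lowerSeries_one y y)
  -- Multiply `y^2 = c x^2 + d x^3` by `x`: the left side is `(x * y) * y = 0`, the right side `c
  -- x^3`.
  have hc : c = 0 := by
    have : x * (y * y) = c • (x * (x * x)) := by
      rw [hcd, mul_add, mul_smul_comm, mul_smul_comm, hx4, smul_zero, add_zero]
    rw [← mul_assoc, hxy, zero_mul] at this
    exact (smul_eq_zero.1 this.symm).resolve_right hx3
  rw [hc, zero_smul, zero_add] at hcd
  have hyx : y * x = 0 := by rw [mul_comm, hxy]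
  have hyx' (w : A) : y * (x * w) = 0 := by rw [← mul_assoc, hyx, zero_mul]
  obtain ⟨e, he, hsq⟩ := exists_smul_sq_eq _ _ _ hcd
  rcases hsq with hsq | hsq
  · refine ⟨7, by decide, isomorphic_of_products hA x (x * x) (e • y) (x * (x * x))
      (fun w => ?_) fun i j => ?_⟩
    · obtain ⟨r, s, t, q, rfl⟩ := hspan w
      exact ⟨r, s, q * e⁻¹, t, by rw [smul_smul, inv_mul_cancel_right₀ he]; abel⟩
    · rw [smul_mul_smul_comm] at hsq
      fin_cases i <;> fin_cases j <;>
        simp [structConst, table, mul_assoc, smul_smul, smul_mul_assoc, mul_smul_comm, hx4,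
          hxy, hyx, hyx', hsq]
  · have hyy : y * y = 0 := by
      rw [smul_mul_smul_comm] at hsq
      exact (smul_eq_zero.1 hsq).resolve_left (mul_ne_zero he he)
    refine ⟨4, by decide, isomorphic_of_products hA x (x * x) (x * (x * x)) y hspan fun i j => ?_⟩
    fin_cases i <;> fin_cases j <;>
      simp [structConst, table, mul_assoc, hx4, hxy, hyx, hyx', hyy]

theorem exists_isomorphic_J4 [IsAlgClosed K] (h2 : (2 : K) ≠ 0)
    (hA : Module.finrank K A = 4) (hnil : IsNilpotentAlg K A) :
    ∃ k ∈ assocIndices, Isomorphic K A (J4 K k) := by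
  have : FiniteDimensional K A := Module.finite_of_finrank_eq_succ hA
  have hlt : Module.finrank K (lowerSeries K A 1) < 4 := by
    have hne : lowerSeries K A 0 ≠ ⊥ := fun hbot => by
      have h0 : Module.finrank K (lowerSeries K A 0) = 4 := (finrank_top K A).trans hA
      rw [hbot, finrank_bot] at h0
      omega
    exact hA ▸ (finrank_lowerSeries_succ_lt hnil hne).trans_le (Submodule.finrank_le _)
  obtain h | h | h | h : Module.finrank K (lowerSeries K A 1) = 0 ∨
      Module.finrank K (lowerSeries K A 1) = 1 ∨ Module.finrank K (lowerSeries K A 1) = 2 ∨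
      Module.finrank K (lowerSeries K A 1) = 3 := by omega
  · exact ⟨1, by decide, isomorphic_one hA (Submodule.finrank_eq_zero.1 h)⟩
  · exact exists_isomorphic_of_finrank_one h2 hA hnil h
  · by_cases hL2 : lowerSeries K A 2 = ⊥
    · exact exists_isomorphic_of_square_eq_bot h2 hA h hL2
    · exact exists_isomorphic_of_square_ne_bot h2 hA hnil h hL2
  · exact ⟨11, by decide, isomorphic_eleven hA hnil h⟩

end Classification

end NilpotentAlgebra

theorem mainTheorem4 (K : Type*) [Field K] [IsAlgClosed K] (hK : ringChar K ≠ 2) :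
    -- the list has nine members
    NilpotentAlgebra.assocIndices.card = 9 ∧
    -- each is a nilpotent associative algebra of dimension four (commutative by construction)
    (∀ k ∈ NilpotentAlgebra.assocIndices,
      Module.finrank K (NilpotentAlgebra.J4 K k) = 4 ∧
      (∀ x y : NilpotentAlgebra.J4 K k, x * y = y * x) ∧
      (∀ x y z : NilpotentAlgebra.J4 K k, x * y * z = x * (y * z)) ∧
      NilpotentAlgebra.IsNilpotentAlg K (NilpotentAlgebra.J4 K k)) ∧
    -- they are pairwise non-isomorphic
    (∀ k ∈ NilpotentAlgebra.assocIndices, ∀ l ∈ NilpotentAlgebra.assocIndices, k ≠ l →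
      ¬ NilpotentAlgebra.Isomorphic K (NilpotentAlgebra.J4 K k) (NilpotentAlgebra.J4 K l)) ∧
    -- every commutative nilpotent associative algebra of dimension four is one of them
    (∀ (A : Type*) [NonUnitalCommRing A] [Module K A] [IsScalarTower K A A] [SMulCommClass K A A],
      Module.finrank K A = 4 → NilpotentAlgebra.IsNilpotentAlg K A →
      ∃ k ∈ NilpotentAlgebra.assocIndices,
        NilpotentAlgebra.Isomorphic K A (NilpotentAlgebra.J4 K k)) ∧
    -- among `J_{4,1}, …, J_{4,13}` they are exactly the associative ones
    (∀ k ∈ Finset.Icc 1 13,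
      (∀ x y z : NilpotentAlgebra.J4 K k, x * y * z = x * (y * z)) ↔
        k ∈ NilpotentAlgebra.assocIndices) ∧
    -- the first four have a central component, the other five have none
    (∀ k ∈ NilpotentAlgebra.assocIndices,
      NilpotentAlgebra.HasCentralComponent K (NilpotentAlgebra.J4 K k) ↔ k ≤ 4) := by
  have h2 : (2 : K) ≠ 0 := Ring.two_ne_zero hK
  refine ⟨by decide, fun k hk => ⟨NilpotentAlgebra.J4.finrank, mul_comm,
      NilpotentAlgebra.J4.mul_assoc hk, NilpotentAlgebra.isNilpotentAlg_J4 k hk⟩,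
    fun k hk l hl => NilpotentAlgebra.not_isomorphic_J4 h2 hk hl,
    fun A _ _ _ _ => NilpotentAlgebra.exists_isomorphic_J4 h2,
    fun k hk => ⟨fun h => ?_, NilpotentAlgebra.J4.mul_assoc⟩,
    fun k => NilpotentAlgebra.hasCentralComponent_J4_iff⟩
  by_contra hk'
  exact NilpotentAlgebra.J4.not_assoc hk hk' h
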